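/- Let $r\ge 3$ be an integer and let $\rho,\gamma\in(0,1)$. In game $A$ the player tosses a fair coin. In game $B$ the player tosses a coin with probability of heads $$p_0=\frac{\rho^{r-1}}{1+\rho^{r-1}}$$ if the player's current (integer) capital is a multiple of $r$, and a coin with probability of heads $$p_1=\frac{1}{1+\rho}$$ otherwise; thus $(1-p_0)(1-p_1)^{r-1}=p_0\,p_1^{r-1}$, that is, game $B$ is fair. In either game the player wins one unit with heads and loses one unit with tails. In the random mixture $\gamma A+(1-\gamma)B$, at each turn, independently of everything before, game $A$ is played with probability $\gamma$ and game $B$ otherwise. Let $S_n$ be the cumulative profit after $n$ turns. Then there is a unique real number $\mu(r,\rho,\gamma A+(1-\gamma)B)$, the rate of profit, such that, from every initial capital, $\lim_{n\to\infty}n^{-1}S_n=\mu(r,\rho,\gamma A+(1-\gamma)B)$ almost surely, and $$\sup_{r\ge 3,\ \rho\in(0,1),\ \gamma\in(0,1)}\mu\big(r,\rho,\gamma A+(1-\gamma)B\big)=1.$$ -/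

import Mathlib

namespace Parrondo

open MeasureTheory ProbabilityTheory Filter Topology
open scoped unitInterval

/-- The probability `1 / 2`, used by game `A`. -/
noncomputable def half : I :=
  ⟨1 / 2, by norm_num, by norm_num⟩

/-- Head probability of the coin that game `B` uses when the capital is a multiple of `r`. -/
noncomputable def p₀ (r : ℕ) (ρ : I) : I :=
  ⟨(ρ : ℝ) ^ (r - 1) / (1 + (ρ : ℝ) ^ (r - 1)),
    unitInterval.div_mem (pow_nonneg ρ.2.1 _)
      (add_nonneg zero_le_one (pow_nonneg ρ.2.1 _)) (le_add_of_nonneg_left zero_le_one)⟩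

/-- Head probability of the coin that game `B` uses when the capital is not a multiple of `r`. -/
noncomputable def p₁ (ρ : I) : I :=
  ⟨1 / (1 + (ρ : ℝ)),
    unitInterval.div_mem zero_le_one (add_nonneg zero_le_one ρ.2.1)
      (le_add_of_nonneg_right ρ.2.1)⟩

/-- The law of the profit from one toss of a `p`-coin: `+1` (heads) with probability `p`,
`-1` (tails) with probability `1 - p`. -/
noncomputable def coin (p : I) : Measure ℤ :=
  bernoulliMeasure 1 (-1) p

/-- The randomness of one turn: whether game `A` is selected, and the results of game `A`'s coin,
of game `B`'s `p₀`-coin and of game `B`'s `p₁`-coin. -/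
abbrev Turn : Type := Bool × ℤ × ℤ × ℤ

/-- In one turn, game `A` is selected with probability `γ` (game `B` otherwise), independently of
the three coins, which are independent of each other. -/
noncomputable def turnLaw (r : ℕ) (ρ γ : I) : Measure Turn :=
  (bernoulliMeasure true false γ).prod
    ((coin half).prod ((coin (p₀ r ρ)).prod (coin (p₁ ρ))))

/-- The profit made in a turn when the capital before it is `x`. Of the two coins of game `B`,
only the one that the current capital designates is used. -/
def profit (r : ℕ) (x : ℤ) (t : Turn) : ℤ :=
  match t with
  | (selectA, a, b₀, b₁) =>
    if selectA = true then a
    else if (r : ℤ) ∣ x then b₀ else b₁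

/-- The capital after `n` turns, from initial capital `x`. -/
def capital (r : ℕ) (x : ℤ) (ω : ℕ → Turn) : ℕ → ℤ
  | 0 => x
  | n + 1 => capital r x ω n + profit r (capital r x ω n) (ω n)

/-- The law of the random mixture `γ A + (1 - γ) B`: the turns are independent and identically
distributed. -/
noncomputable def mixtureLaw (r : ℕ) (ρ γ : I) : Measure (ℕ → Turn) :=
  Measure.infinitePi (fun _ : ℕ => turnLaw r ρ γ)

/-- `m` is the rate of profit of `γ A + (1 - γ) B`: from every initial capital, the cumulative
profit per game played converges almost surely to `m`. -/
def IsRateOfProfit (r : ℕ) (ρ γ : I) (m : ℝ) : Prop :=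
  ∀ x : ℤ, ∀ᵐ ω ∂(mixtureLaw r ρ γ),
    Tendsto (fun n : ℕ => ((capital r x ω n - x : ℤ) : ℝ) / (n : ℝ)) atTop (𝓝 m)

end Parrondo

namespace Parrondo

open MeasureTheory ProbabilityTheory Filter Topology
open scoped unitInterval

/-! ### Strong law for bounded orthogonal increments -/

section LawOfLargeNumbers

variable {Ω : Type*} [MeasurableSpace Ω] {P : Measure Ω} [IsProbabilityMeasure P]
  {M : ℕ → Ω → ℝ} {C : ℝ}

/-! The capital is a walk on the integers that goes up with probability `a` at multiples of `r` and
`p` elsewhere, where `a ≤ p` and `p > 1/2`. If `f` stays at bounded distance from the identity and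
its expected one-step increment is the constant `m`, then `f(X_n) - n m` is a martingale with
bounded increments, so `X_n / n → m` almost surely (`isRateOfProfit_of_poisson`). Such an `f` is
found explicitly (`exists_poisson_solution`), with `m = speed r a p`.

The formula gives `speed ≤ 1`. With `ρ`, `γ` fixed and `r → ∞`, the speed approaches `2p - 1`
(`le_speed`, `drift_le_of_speed_le`); with `ρ = γ → 0`, `p → 1`, so no bound below `1` is possible.
-/

lemma abs_sub_le_of_abs_increment_le {u : ℕ → ℝ} (hu : ∀ n, |u (n + 1) - u n| ≤ C) (n k : ℕ) :
    |u (n + k) - u n| ≤ k * C := by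
  induction k with
  | zero => simp
  | succ k ih =>
    calc |u (n + (k + 1)) - u n|
        ≤ |u (n + k + 1) - u (n + k)| + |u (n + k) - u n| := abs_sub_le _ _ _
      _ ≤ C + k * C := add_le_add (hu _) ih
      _ = (k + 1 : ℕ) * C := by push_cast; ring

/-- Filling the gaps between consecutive squares for a sequence with bounded increments. -/
lemma tendsto_div_of_tendsto_sq_div {u : ℕ → ℝ} (hu : ∀ n, |u (n + 1) - u n| ≤ C)
    (h : Tendsto (fun n : ℕ => u (n ^ 2) / (n : ℝ) ^ 2) atTop (𝓝 0)) :
    Tendsto (fun n : ℕ => u n / (n : ℝ)) atTop (𝓝 0) := by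
  have hC : 0 ≤ C := (abs_nonneg _).trans (hu 0)
  have hlim : Tendsto (fun n : ℕ => |u (n ^ 2) / (n : ℝ) ^ 2| + 2 * C / n) atTop (𝓝 0) := by
    simpa using h.abs.add (tendsto_const_div_atTop_nhds_zero_nat (2 * C))
  have hsqrt : Tendsto Nat.sqrt atTop atTop :=
    tendsto_atTop.2 fun b => by
      filter_upwards [eventually_ge_atTop (b ^ 2)] with n hn
      exact Nat.le_sqrt'.2 hn
  refine squeeze_zero_norm' ?_ (hlim.comp hsqrt)
  filter_upwards [eventually_ge_atTop 1] with k hk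
  have hn : 1 ≤ Nat.sqrt k := Nat.le_sqrt'.2 (by simpa using hk)
  have hle : Nat.sqrt k ^ 2 ≤ k := Nat.sqrt_le' k
  have hge : k ≤ Nat.sqrt k * Nat.sqrt k + Nat.sqrt k + Nat.sqrt k := Nat.sqrt_le_add k
  set n := Nat.sqrt k
  have hn' : (0 : ℝ) < n := by exact_mod_cast hn
  obtain ⟨j, hj⟩ := Nat.exists_eq_add_of_le hle
  have hj2 : j ≤ 2 * n := by nlinarith
  have hj2' : (j : ℝ) ≤ 2 * n := by exact_mod_cast hj2
  have hkn : (n : ℝ) ^ 2 ≤ k := by exact_mod_cast hle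
  have hgap : |u k - u (n ^ 2)| ≤ 2 * n * C := by
    rw [hj]
    exact (abs_sub_le_of_abs_increment_le hu _ _).trans (by gcongr)
  have habs : |u k| ≤ |u (n ^ 2)| + 2 * n * C := by
    have := abs_sub_abs_le_abs_sub (u k) (u (n ^ 2))
    linarith
  simp only [Function.comp_apply, Real.norm_eq_abs, abs_div, Nat.abs_cast, abs_pow]
  calc |u k| / k ≤ (|u (n ^ 2)| + 2 * n * C) / (n : ℝ) ^ 2 := by gcongr
    _ = |u (n ^ 2)| / (n : ℝ) ^ 2 + 2 * C / n := by field_simp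

/-- Orthogonality kills the cross term of the expanded square, so the second moments of the
increments add up. -/
lemma integral_sq_le_of_orthogonal_increments (hM : ∀ n, Measurable (M n)) (h0 : ∀ ω, M 0 ω = 0)
    (hC : ∀ᵐ ω ∂P, ∀ n, |M (n + 1) ω - M n ω| ≤ C)
    (horth : ∀ n, ∫ ω, M n ω * (M (n + 1) ω - M n ω) ∂P = 0) (n : ℕ) :
    Integrable (fun ω => M n ω ^ 2) P ∧ ∫ ω, M n ω ^ 2 ∂P ≤ n * C ^ 2 := by
  have hbound : ∀ n, ∀ᵐ ω ∂P, |M n ω| ≤ n * C := fun n => by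
    filter_upwards [hC] with ω hω
    simpa [h0] using abs_sub_le_of_abs_increment_le (u := fun n => M n ω) hω 0 n
  have hint : ∀ n, Integrable (fun ω => M n ω ^ 2) P := fun n => by
    refine Integrable.of_bound ((hM n).pow_const 2).aestronglyMeasurable ((n * C) ^ 2) ?_
    filter_upwards [hbound n] with ω hω
    rw [norm_pow]
    exact pow_le_pow_left₀ (norm_nonneg _) hω 2
  refine ⟨hint n, ?_⟩
  induction n with
  | zero => simp [h0]
  | succ n ih =>
    have hcross : Integrable (fun ω => M n ω * (M (n + 1) ω - M n ω)) P := by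
      refine Integrable.of_bound
        ((hM n).mul ((hM (n + 1)).sub (hM n))).aestronglyMeasurable (n * C * C) ?_
      filter_upwards [hbound n, hC] with ω hω hω'
      rw [norm_mul]
      exact mul_le_mul hω (hω' n) (norm_nonneg _) ((abs_nonneg _).trans hω)
    have hinc : Integrable (fun ω => (M (n + 1) ω - M n ω) ^ 2) P := by
      refine Integrable.of_bound
        (((hM (n + 1)).sub (hM n)).pow_const 2).aestronglyMeasurable (C ^ 2) ?_
      filter_upwards [hC] with ω hω
      rw [norm_pow]
      exact pow_le_pow_left₀ (norm_nonneg _) (hω n) 2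
    have hincle : ∫ ω, (M (n + 1) ω - M n ω) ^ 2 ∂P ≤ C ^ 2 := by
      calc ∫ ω, (M (n + 1) ω - M n ω) ^ 2 ∂P ≤ ∫ _, C ^ 2 ∂P := by
            refine integral_mono_ae hinc (integrable_const _) ?_
            filter_upwards [hC] with ω hω
            exact sq_le_sq' (abs_le.1 (hω n)).1 (abs_le.1 (hω n)).2
        _ = C ^ 2 := by simp
    calc ∫ ω, M (n + 1) ω ^ 2 ∂P
        = ∫ ω, (M n ω ^ 2 + 2 * (M n ω * (M (n + 1) ω - M n ω))
            + (M (n + 1) ω - M n ω) ^ 2) ∂P := by congr 1; ext ω; ring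
      _ = ∫ ω, M n ω ^ 2 ∂P + ∫ ω, (M (n + 1) ω - M n ω) ^ 2 ∂P := by
          have hsum : Integrable
              (fun ω => M n ω ^ 2 + 2 * (M n ω * (M (n + 1) ω - M n ω))) P :=
            (hint n).add (hcross.const_mul 2)
          rw [integral_add hsum hinc, integral_add (hint n) (hcross.const_mul 2),
            integral_const_mul, horth]
          ring
      _ ≤ n * C ^ 2 + C ^ 2 := add_le_add ih hincle
      _ = (n + 1 : ℕ) * C ^ 2 := by push_cast; ring

/-- Strong law of large numbers for sums of bounded orthogonal increments. -/
theorem ae_tendsto_div_of_orthogonal_increments (hM : ∀ n, Measurable (M n))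
    (h0 : ∀ ω, M 0 ω = 0) (hC : ∀ᵐ ω ∂P, ∀ n, |M (n + 1) ω - M n ω| ≤ C)
    (horth : ∀ n, ∫ ω, M n ω * (M (n + 1) ω - M n ω) ∂P = 0) :
    ∀ᵐ ω ∂P, Tendsto (fun n : ℕ => M n ω / (n : ℝ)) atTop (𝓝 0) := by
  have hL2 := integral_sq_le_of_orthogonal_increments hM h0 hC horth
  -- Along squares, the second-moment bound gives `F n` mean at most `C ^ 2 / n ^ 2`; summability
  -- forces `F n → 0` almost surely.
  let F : ℕ → Ω → ℝ := fun n ω => M (n ^ 2) ω ^ 2 / (n : ℝ) ^ 4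
  have hF : ∀ n, AEStronglyMeasurable (F n) P := fun n =>
    (((hM _).pow_const 2).div_const _).aestronglyMeasurable
  have hnorm : ∀ n, eLpNorm (F n) 1 P ≤ ENNReal.ofReal (C ^ 2 * (1 / (n : ℝ) ^ 2)) := fun n => by
    have hi : Integrable (F n) P := (hL2 (n ^ 2)).1.div_const _
    rw [eLpNorm_one_eq_lintegral_enorm, ← ofReal_integral_norm_eq_lintegral_enorm hi]
    refine ENNReal.ofReal_le_ofReal ?_
    have : ∀ ω, ‖F n ω‖ = M (n ^ 2) ω ^ 2 / (n : ℝ) ^ 4 := fun ω => by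
      rw [Real.norm_of_nonneg]; positivity
    simp only [this]
    rw [integral_div]
    calc (∫ ω, M (n ^ 2) ω ^ 2 ∂P) / (n : ℝ) ^ 4 ≤ ((n ^ 2 : ℕ) * C ^ 2) / (n : ℝ) ^ 4 := by
          gcongr; exact (hL2 _).2
      _ = C ^ 2 * (1 / (n : ℝ) ^ 2) := by
          rcases eq_or_ne n 0 with rfl | hn
          · simp
          · push_cast; field_simp
  have hsum : ∑' n, eLpNorm (F n) 1 P ≠ ⊤ := by
    refine ne_top_of_le_ne_top ?_ (ENNReal.tsum_le_tsum hnorm)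
    exact ((Real.summable_one_div_nat_pow.2 one_lt_two).mul_left (C ^ 2)).tsum_ofReal_ne_top
  filter_upwards [summable_norm_of_tsum_eLpNorm_ne_top le_rfl hF hsum, hC] with ω hω hCω
  refine tendsto_div_of_tendsto_sq_div (u := fun n => M n ω) hCω ?_
  have hlim := hω.tendsto_atTop_zero
  rw [tendsto_zero_iff_abs_tendsto_zero]
  have := hlim.sqrt
  rw [Real.sqrt_zero] at this
  refine this.congr fun n => ?_
  have : ‖F n ω‖ = (M (n ^ 2) ω / (n : ℝ) ^ 2) ^ 2 := by
    rw [Real.norm_of_nonneg (by positivity)]; simp only [F]; ring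
  rw [this, Real.sqrt_sq_eq_abs]; rfl

end LawOfLargeNumbers

/-! ### The speed of the periodic walk and its Poisson equation -/

section PoissonEquation

/-- The quantity whose sign decides whether the walk that goes up with probability `a` at multiples
of `r` and with probability `p` elsewhere drifts upwards. -/
noncomputable def bias (r : ℕ) (a p : ℝ) : ℝ :=
  a - (1 - a) * ((1 - p) / p) ^ (r - 1)

/-- The normalizing constant in the rate of the periodic walk. -/
noncomputable def normalizer (r : ℕ) (a p : ℝ) : ℝ :=
  r * bias r a p + 2 * (p - a) * ∑ i ∈ Finset.range r, ((1 - p) / p) ^ i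

/-- The asymptotic speed of the walk on `ℤ` that goes up with probability `a` at multiples of `r`
and with probability `p` elsewhere. -/
noncomputable def speed (r : ℕ) (a p : ℝ) : ℝ :=
  r * bias r a p / normalizer r a p * (2 * p - 1)

variable {r : ℕ} {a p : ℝ}

lemma ratio_nonneg (hp : 1 / 2 < p) (hp1 : p ≤ 1) : 0 ≤ (1 - p) / p :=
  div_nonneg (by linarith) (by linarith)

lemma ratio_lt_one (hp : 1 / 2 < p) : (1 - p) / p < 1 := by
  rw [div_lt_one (by linarith)]; linarith

/-- The bias may be negative. But each of the `r` geometric terms is at least the last one, `T`, so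
the normalizer is at least `r * (a * (1 - T) + T * (2 * p - 1))`. -/
lemma normalizer_pos (hr : 2 ≤ r) (ha : 0 < a) (hap : a ≤ p) (hp : 1 / 2 < p) (hp1 : p ≤ 1) :
    0 < normalizer r a p := by
  have h0 := ratio_nonneg hp hp1
  have h1 := ratio_lt_one hp
  unfold normalizer bias
  set θ := (1 - p) / p
  have hT0 : 0 ≤ θ ^ (r - 1) := pow_nonneg h0 _
  have hT1 : θ ^ (r - 1) < 1 := pow_lt_one₀ h0 h1 (by omega)
  have hsum : r * θ ^ (r - 1) ≤ ∑ i ∈ Finset.range r, θ ^ i := by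
    rw [← nsmul_eq_mul]
    simpa using Finset.card_nsmul_le_sum (Finset.range r) (fun i => θ ^ i) (θ ^ (r - 1))
      fun i hi => pow_le_pow_of_le_one h0 h1.le (by have := Finset.mem_range.1 hi; omega)
  set T := θ ^ (r - 1)
  have hr0 : (0 : ℝ) < r := by exact_mod_cast (by omega : 0 < r)
  have hmul := mul_le_mul_of_nonneg_left hsum (by linarith : 0 ≤ 2 * (p - a))
  have hpos : 0 < a * (1 - T) + T * (2 * p - 1) :=
    add_pos_of_pos_of_nonneg (mul_pos ha (by linarith)) (mul_nonneg hT0 (by linarith))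
  nlinarith [mul_pos hr0 hpos]

lemma speed_le_one (hr : 2 ≤ r) (ha : 0 < a) (hap : a ≤ p) (hp : 1 / 2 < p) (hp1 : p ≤ 1) :
    speed r a p ≤ 1 := by
  have hN := normalizer_pos hr ha hap hp hp1
  have h0 := ratio_nonneg hp hp1
  have hle : r * bias r a p / normalizer r a p ≤ 1 := by
    rw [div_le_one hN, normalizer]
    have : 0 ≤ 2 * (p - a) * ∑ i ∈ Finset.range r, ((1 - p) / p) ^ i :=
      mul_nonneg (by linarith) (Finset.sum_nonneg fun i _ => pow_nonneg h0 i)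
    linarith
  unfold speed
  nlinarith

/-- The geometric sum is bounded independently of `r`, while the bias is at least `a - T ≥ g / 4`.
So the normalizer exceeds `r * bias` by a bounded amount and is itself at least `r * g / 4`. -/
lemma le_speed {g : ℝ} (hr : 2 ≤ r) (hg : 0 < g) (hga : g / 2 ≤ a) (hap : a ≤ p)
    (hp : 1 / 2 < p) (hp1 : p ≤ 1) (hT : ((1 - p) / p) ^ (r - 1) ≤ g / 4) :
    (2 * p - 1) * (1 - 8 / ((1 - (1 - p) / p) * g) / r) ≤ speed r a p := by
  have ha : 0 < a := by linarith
  have hN := normalizer_pos hr ha hap hp hp1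
  have h0 := ratio_nonneg hp hp1
  have h1 := ratio_lt_one hp
  have hr0 : (0 : ℝ) < r := by exact_mod_cast (by omega : 0 < r)
  have hgeom : ∑ i ∈ Finset.range r, ((1 - p) / p) ^ i ≤ 1 / (1 - (1 - p) / p) := by
    rw [le_div_iff₀ (by linarith)]
    have := geom_sum_mul_neg ((1 - p) / p) r
    have := pow_nonneg h0 r
    linarith
  have hs0 : 0 ≤ ∑ i ∈ Finset.range r, ((1 - p) / p) ^ i :=
    Finset.sum_nonneg fun i _ => pow_nonneg h0 i
  have hbias : g / 4 ≤ bias r a p := by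
    have := pow_nonneg h0 (r - 1)
    unfold bias
    nlinarith
  have hrest : 2 * (p - a) * ∑ i ∈ Finset.range r, ((1 - p) / p) ^ i
      ≤ 2 * (1 / (1 - (1 - p) / p)) := by
    have : 2 * (p - a) ≤ 2 := by linarith
    exact mul_le_mul this hgeom hs0 zero_le_two
  have hrest0 : 0 ≤ 2 * (p - a) * ∑ i ∈ Finset.range r, ((1 - p) / p) ^ i :=
    mul_nonneg (by linarith) hs0
  have hrg : r * (g / 4) ≤ normalizer r a p := by
    unfold normalizer
    have := mul_le_mul_of_nonneg_left hbias hr0.le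
    linarith
  have hquot : 1 - 8 / ((1 - (1 - p) / p) * g) / r ≤ r * bias r a p / normalizer r a p := by
    have heq : r * bias r a p / normalizer r a p
        = 1 - 2 * (p - a) * (∑ i ∈ Finset.range r, ((1 - p) / p) ^ i) / normalizer r a p := by
      rw [eq_sub_iff_add_eq, ← add_div]
      exact div_self hN.ne'
    rw [heq]
    refine sub_le_sub_left ?_ 1
    calc 2 * (p - a) * (∑ i ∈ Finset.range r, ((1 - p) / p) ^ i) / normalizer r a p
        ≤ 2 * (1 / (1 - (1 - p) / p)) / (r * (g / 4)) :=
          div_le_div₀ (by have := sub_pos.2 h1; positivity) hrest (by positivity) hrg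
      _ = 8 / ((1 - (1 - p) / p) * g) / r := by
          have := (sub_pos.2 h1).ne'
          set θ := (1 - p) / p
          field_simp
          norm_num
  unfold speed
  rw [mul_comm]
  exact mul_le_mul_of_nonneg_right hquot (by linarith)

/-- A solution `G` of the Poisson equation on one period `{0, …, r}`. -/
lemma exists_poisson_period (hr : 2 ≤ r) (ha : 0 < a) (hap : a ≤ p) (hp : 1 / 2 < p)
    (hp1 : p ≤ 1) :
    ∃ G : ℕ → ℝ, G 0 = 0 ∧ G r = r ∧
      (∀ j, p * G (j + 2) + (1 - p) * G j - G (j + 1) = speed r a p) ∧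
      a * G 1 + (1 - a) * (G (r - 1) - r) = speed r a p := by
  have hN := (normalizer_pos hr ha hap hp hp1).ne'
  have hp0 : p ≠ 0 := by linarith
  obtain ⟨n, rfl⟩ : ∃ n, r = n + 1 := ⟨r - 1, by omega⟩
  set θ := (1 - p) / p with hθ
  have hq : 1 - p = p * θ := by rw [hθ]; field_simp
  set D := bias (n + 1) a p with hD
  set E := normalizer (n + 1) a p with hE
  have hEeq : E = (n + 1 : ℕ) * D + 2 * (p - a) * ∑ i ∈ Finset.range (n + 1), θ ^ i := rfl
  have hDeq : D = a - (1 - a) * θ ^ n := rfl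
  -- Off the multiples of `r`, constants and `θ ^ j` solve the homogeneous equation, hence the
  -- ansatz `c * j + K * ∑ θ ^ i`. The equation at a multiple of `r` becomes `K * D = c * 2 * (p -
  -- a)`, and `G r = r` fixes the scale.
  set c : ℝ := (n + 1 : ℕ) * D / E with hc
  set K : ℝ := (n + 1 : ℕ) * (2 * (p - a)) / E with hK
  have hspeed : speed (n + 1) a p = c * (2 * p - 1) := rfl
  have hKD : K * D = c * (2 * (p - a)) := by rw [hK, hc]; ring
  have hG : c * (n + 1 : ℕ) + K * ∑ i ∈ Finset.range (n + 1), θ ^ i = (n + 1 : ℕ) := by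
    rw [hK, hc]
    field_simp
    rw [hEeq]
  refine ⟨fun j => c * j + K * ∑ i ∈ Finset.range j, θ ^ i, by simp, hG, fun j => ?_, ?_⟩
  · simp only [Finset.sum_range_succ, pow_succ]
    rw [hspeed]
    push_cast
    have h : p * (1 + θ) = 1 := by linarith
    clear_value θ c K
    linear_combination K * θ ^ j * h
  · rw [hspeed]
    rw [Finset.sum_range_succ] at hG
    simp only [Nat.add_sub_cancel, Finset.sum_range_one, pow_zero]
    push_cast at hG ⊢
    rw [hDeq] at hKD
    linear_combination (1 - a) * hG + hKD

end PoissonEquation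

/-- A solution of the Poisson equation of the periodic walk, at bounded distance from the
identity. -/
theorem exists_poisson_solution {r : ℕ} {a p : ℝ} (hr : 2 ≤ r) (ha : 0 < a) (hap : a ≤ p)
    (hp : 1 / 2 < p) (hp1 : p ≤ 1) :
    ∃ (f : ℤ → ℝ) (B : ℝ), (∀ y, |f y - y| ≤ B) ∧
      ∀ y : ℤ, (if (r : ℤ) ∣ y then a else p) * f (y + 1)
        + (1 - if (r : ℤ) ∣ y then a else p) * f (y - 1) - f y = speed r a p := by
  obtain ⟨G, hG0, hGr, hG, hGb⟩ := exists_poisson_period hr ha hap hp hp1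
  have hrpos : (0 : ℤ) < r := by omega
  let f : ℤ → ℝ := fun y => r * ((y / r : ℤ) : ℝ) + G (y % r).toNat
  -- The endpoint `j = r` is included, thanks to `G 0 = 0` and `G r = r`, so that the upper
  -- neighbour of the last point of a period is covered.
  have hf : ∀ (k : ℤ) (j : ℕ), j ≤ r → f (r * k + j) = r * k + G j := fun k j hj => by
    simp only [f]
    rcases hj.lt_or_eq with hlt | rfl
    · have hlt' : (j : ℤ) < r := by exact_mod_cast hlt
      rw [Int.mul_add_ediv_left _ _ hrpos.ne', Int.mul_add_emod_self_left,
        Int.ediv_eq_zero_of_lt (by omega) hlt', Int.emod_eq_of_lt (by omega) hlt']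
      simp
    · rw [show (j : ℤ) * k + j = j * (k + 1) by ring, Int.mul_ediv_cancel_left _ hrpos.ne',
        Int.mul_emod_right]
      simp [hG0, hGr]
      ring
  have hdecomp : ∀ y : ℤ, ∃ (k : ℤ) (j : ℕ), j < r ∧ y = r * k + j := fun y => by
    have h0 := Int.emod_nonneg y hrpos.ne'
    have h1 := Int.emod_lt_of_pos y hrpos
    refine ⟨y / r, (y % r).toNat, by omega, ?_⟩
    rw [Int.toNat_of_nonneg h0]
    exact (Int.mul_ediv_add_emod y r).symm
  refine ⟨f, ∑ j ∈ Finset.range r, |G j - j|, fun y => ?_, fun y => ?_⟩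
  · obtain ⟨k, j, hj, rfl⟩ := hdecomp y
    rw [hf k j hj.le]
    push_cast
    rw [add_sub_add_left_eq_sub]
    exact Finset.single_le_sum (f := fun j : ℕ => |G j - j|) (fun _ _ => abs_nonneg _)
      (Finset.mem_range.2 hj)
  · obtain ⟨k, j, hj, rfl⟩ := hdecomp y
    rcases j with _ | j
    · have h1 : (r : ℤ) * k + (0 : ℕ) - 1 = r * (k - 1) + (r - 1 : ℕ) := by
        push_cast [Nat.cast_sub (by omega : 1 ≤ r)]; ring
      have h2 : (r : ℤ) * k + (0 : ℕ) + 1 = r * k + (1 : ℕ) := by push_cast; ring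
      rw [h1, h2, hf _ _ (by omega), hf _ _ (by omega), hf _ _ (by omega), hG0,
        if_pos (by simp)]
      push_cast
      linear_combination hGb
    · have hnd : ¬ (r : ℤ) ∣ r * k + (j + 1 : ℕ) := by
        rw [Int.dvd_add_right (dvd_mul_right _ _), Int.natCast_dvd_natCast]
        exact Nat.not_dvd_of_pos_of_lt (by omega) hj
      have h1 : (r : ℤ) * k + (j + 1 : ℕ) - 1 = r * k + j := by push_cast; ring
      have h2 : (r : ℤ) * k + (j + 1 : ℕ) + 1 = r * k + (j + 2 : ℕ) := by push_cast; ring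
      rw [h1, h2, hf _ _ (by omega), hf _ _ (by omega), hf _ _ (by omega), if_neg hnd]
      linear_combination hG j

/-! ### The law of a single turn -/

section Turns

instance (p : I) : IsProbabilityMeasure (coin p) := by
  unfold coin; infer_instance

instance (r : ℕ) (ρ γ : I) : IsProbabilityMeasure (turnLaw r ρ γ) := by
  unfold turnLaw; infer_instance

instance (r : ℕ) (ρ γ : I) : IsProbabilityMeasure (mixtureLaw r ρ γ) := by
  unfold mixtureLaw; infer_instance

/-- The probability of a win when the selected game is random and game `B` uses a `q`-coin. -/
noncomputable def mixedProb (γ q : I) : ℝ := γ * (1 / 2) + (1 - γ) * q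

/-- The probability of winning a turn of the mixture with current capital `y`. -/
noncomputable def winProb (r : ℕ) (ρ γ : I) (y : ℤ) : ℝ :=
  if (r : ℤ) ∣ y then mixedProb γ (p₀ r ρ) else mixedProb γ (p₁ ρ)

lemma ae_coin (p : I) : ∀ᵐ z ∂coin p, z = 1 ∨ z = -1 := by
  rw [ae_iff]
  exact bernoulliMeasure_apply_of_notMem_of_notMem p (.of_discrete) (by simp) (by simp)

lemma ae_profit (r : ℕ) (ρ γ : I) :
    ∀ᵐ t ∂turnLaw r ρ γ, ∀ y, profit r y t = 1 ∨ profit r y t = -1 := by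
  have h0 := Measure.quasiMeasurePreserving_snd
    (μ := bernoulliMeasure true false γ)
    (ν := (coin half).prod ((coin (p₀ r ρ)).prod (coin (p₁ ρ))))
  have h1 := Measure.quasiMeasurePreserving_snd (μ := coin half)
    (ν := (coin (p₀ r ρ)).prod (coin (p₁ ρ)))
  have ha := h0.ae (Measure.quasiMeasurePreserving_fst.ae (ae_coin half))
  have hb := h0.ae (h1.ae (Measure.quasiMeasurePreserving_fst.ae (ae_coin (p₀ r ρ))))
  have hc := h0.ae (h1.ae (Measure.quasiMeasurePreserving_snd.ae (ae_coin (p₁ ρ))))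
  filter_upwards [ha, hb, hc] with t hta htb htc y
  obtain ⟨s, a, b, c⟩ := t
  simp only [profit]
  split_ifs <;> assumption

lemma integral_coin (p : I) (F : ℤ → ℝ) :
    ∫ z, F z ∂coin p = p * F 1 + (1 - p) * F (-1) := by
  simp [coin, integral_bernoulliMeasure]

lemma integrable_comp_profit (r : ℕ) (ρ γ : I) (y : ℤ) (F : ℤ → ℝ) :
    Integrable (fun t => F (profit r y t)) (turnLaw r ρ γ) := by
  refine Integrable.of_bound (Measurable.of_discrete).aestronglyMeasurable
    (max |F 1| |F (-1)|) ?_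
  filter_upwards [ae_profit r ρ γ] with t ht
  rcases ht y with h | h <;> simp [h]

lemma integral_comp_profit (r : ℕ) (ρ γ : I) (y : ℤ) (F : ℤ → ℝ) :
    ∫ t, F (profit r y t) ∂turnLaw r ρ γ
      = winProb r ρ γ y * F 1 + (1 - winProb r ρ γ y) * F (-1) := by
  have hint := integrable_comp_profit r ρ γ y F
  rw [turnLaw] at hint ⊢
  rw [integral_prod _ hint, integral_bernoulliMeasure]
  have hA : ∫ s, F (profit r y (true, s)) ∂((coin half).prod ((coin (p₀ r ρ)).prod (coin (p₁ ρ))))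
      = 1 / 2 * F 1 + 1 / 2 * F (-1) := by
    have := integral_fun_fst (μ := coin half) (ν := (coin (p₀ r ρ)).prod (coin (p₁ ρ))) F
    rw [integral_coin] at this
    simp only [profit, if_true]
    rw [this]
    norm_num [half]
  rw [hA]
  by_cases hy : (r : ℤ) ∣ y
  · have hB : ∫ s, F (profit r y (false, s))
        ∂((coin half).prod ((coin (p₀ r ρ)).prod (coin (p₁ ρ))))
        = p₀ r ρ * F 1 + (1 - p₀ r ρ) * F (-1) := by
      simp only [profit, hy, if_true, Bool.false_eq_true, if_false]
      rw [integral_fun_snd (μ := coin half) (ν := (coin (p₀ r ρ)).prod (coin (p₁ ρ)))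
        (fun s => F s.1), integral_fun_fst (μ := coin (p₀ r ρ)) (ν := coin (p₁ ρ)) F,
        integral_coin]
      simp
    rw [hB, winProb, if_pos hy, mixedProb, smul_eq_mul, smul_eq_mul]
    ring
  · have hB : ∫ s, F (profit r y (false, s))
        ∂((coin half).prod ((coin (p₀ r ρ)).prod (coin (p₁ ρ))))
        = p₁ ρ * F 1 + (1 - p₁ ρ) * F (-1) := by
      simp only [profit, hy, Bool.false_eq_true, if_false]
      rw [integral_fun_snd (μ := coin half) (ν := (coin (p₀ r ρ)).prod (coin (p₁ ρ)))
        (fun s => F s.2), integral_fun_snd (μ := coin (p₀ r ρ)) (ν := coin (p₁ ρ)) F,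
        integral_coin]
      simp
    rw [hB, winProb, if_neg hy, mixedProb, smul_eq_mul, smul_eq_mul]
    ring

end Turns

/-! ### The capital process and its martingale -/

section Capital

lemma measurable_capital (r : ℕ) (x : ℤ) (n : ℕ) :
    Measurable (fun ω => capital r x ω n) := by
  induction n with
  | zero => exact measurable_const
  | succ n ih =>
    have : Measurable (fun q : ℤ × Turn => q.1 + profit r q.1 q.2) := Measurable.of_discrete
    exact this.comp (ih.prodMk (measurable_pi_apply n))

lemma capital_congr (r : ℕ) (x : ℤ) {ω ω' : ℕ → Turn} (n : ℕ) (h : ∀ i < n, ω i = ω' i) :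
    capital r x ω n = capital r x ω' n := by
  induction n with
  | zero => rfl
  | succ n ih =>
    simp only [capital]
    rw [ih fun i hi => h i (by omega), h n (by omega)]

/-- The capital before turn `n` depends only on earlier turns, so filling the remaining coordinates
with a default value does not change it. -/
lemma indepFun_capital (r : ℕ) (ρ γ : I) (x : ℤ) (n : ℕ) :
    IndepFun (fun ω => capital r x ω n) (fun ω => ω n) (mixtureLaw r ρ γ) := by
  have hindep : iIndepFun (fun (i : ℕ) (ω : ℕ → Turn) => ω i) (mixtureLaw r ρ γ) :=
    iIndepFun_infinitePi (X := fun _ t => t) fun _ => measurable_id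
  have h := hindep.indepFun_finset (Finset.range n) {n} (by simp)
    fun i => measurable_pi_apply i
  let pad : ((i : Finset.range n) → Turn) → ℕ → Turn := fun s i =>
    if hi : i ∈ Finset.range n then s ⟨i, hi⟩ else default
  have hpad : Measurable pad := by
    refine measurable_pi_lambda _ fun i => ?_
    by_cases hi : i ∈ Finset.range n
    · simp only [pad, dif_pos hi]
      exact measurable_pi_apply (⟨i, hi⟩ : Finset.range n)
    · simp only [pad, dif_neg hi]
      exact measurable_const
  have heval : Measurable
      fun s : ({n} : Finset ℕ) → Turn => s ⟨n, Finset.mem_singleton_self n⟩ :=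
    measurable_pi_apply _
  have hcomp := h.comp (φ := fun s => capital r x (pad s) n)
    ((measurable_capital r x n).comp hpad) heval
  refine hcomp.congr (.of_forall fun ω => ?_) (.of_forall fun ω => rfl)
  exact capital_congr r x n fun i hi => by simp [pad, hi]

lemma ae_profit_mixtureLaw (r : ℕ) (ρ γ : I) :
    ∀ᵐ ω ∂mixtureLaw r ρ γ, ∀ n y, profit r y (ω n) = 1 ∨ profit r y (ω n) = -1 :=
  ae_all_iff.2 fun n =>
    (measurePreserving_eval_infinitePi (fun _ : ℕ => turnLaw r ρ γ) n).quasiMeasurePreserving.ae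
      (ae_profit r ρ γ)

/-- Independence makes the joint law a product: the turn can be averaged with the current capital
frozen. -/
lemma integral_capital_turn {r : ℕ} {ρ γ : I} {x : ℤ} {n : ℕ} {F : ℤ → Turn → ℝ}
    (hF : Integrable (fun ω => F (capital r x ω n) (ω n)) (mixtureLaw r ρ γ)) :
    ∫ ω, F (capital r x ω n) (ω n) ∂mixtureLaw r ρ γ
      = ∫ y, ∫ t, F y t ∂turnLaw r ρ γ ∂(mixtureLaw r ρ γ).map (fun ω => capital r x ω n) := by
  have hX := measurable_capital r x n
  have hω : Measurable (fun ω : ℕ → Turn => ω n) := measurable_pi_apply n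
  have hmap := (indepFun_capital r ρ γ x n).map_prod_eq_prod_map_map hX.aemeasurable
    hω.aemeasurable
  have hlaw : (mixtureLaw r ρ γ).map (fun ω => ω n) = turnLaw r ρ γ :=
    Measure.infinitePi_map_eval (fun _ : ℕ => turnLaw r ρ γ) n
  rw [hlaw] at hmap
  have hsm : AEStronglyMeasurable (fun q : ℤ × Turn => F q.1 q.2)
      ((mixtureLaw r ρ γ).map fun ω => (capital r x ω n, ω n)) :=
    (Measurable.of_discrete).aestronglyMeasurable
  have hpair : AEMeasurable (fun ω => (capital r x ω n, ω n)) (mixtureLaw r ρ γ) :=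
    (hX.prodMk hω).aemeasurable
  have hprob : IsProbabilityMeasure ((mixtureLaw r ρ γ).map fun ω => capital r x ω n) :=
    Measure.isProbabilityMeasure_map hX.aemeasurable
  rw [← integral_map (f := fun q : ℤ × Turn => F q.1 q.2) hpair hsm, hmap, integral_prod]
  rw [← hmap]
  exact (integrable_map_measure hsm hpair).2 hF

/-- A bounded perturbation of the identity that solves the Poisson equation of the mixture
determines its rate of profit. -/
theorem isRateOfProfit_of_poisson {r : ℕ} {ρ γ : I} {m B : ℝ} {f : ℤ → ℝ}
    (hB : ∀ y, |f y - y| ≤ B)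
    (hf : ∀ y, winProb r ρ γ y * f (y + 1) + (1 - winProb r ρ γ y) * f (y - 1) - f y = m) :
    IsRateOfProfit r ρ γ m := by
  intro x
  have hB0 : 0 ≤ B := (abs_nonneg _).trans (hB 0)
  let M : ℕ → (ℕ → Turn) → ℝ := fun n ω => f (capital r x ω n) - f x - n * m
  have hstep : ∀ n ω, M (n + 1) ω - M n ω
      = f (capital r x ω n + profit r (capital r x ω n) (ω n)) - f (capital r x ω n) - m :=
    fun n ω => by simp only [M, capital]; push_cast; ring
  have hM : ∀ n, Measurable (M n) := fun n =>
    (((Measurable.of_discrete (f := f)).comp (measurable_capital r x n)).sub_const _).sub_const _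
  have h0 : ∀ ω, M 0 ω = 0 := fun ω => by simp [M, capital]
  have hinc : ∀ y z : ℤ, (z = 1 ∨ z = -1) → |f (y + z) - f y - m| ≤ 2 * B + 1 + |m| := by
    intro y z hz
    have h1 := abs_le.1 (hB (y + z))
    have h2 := abs_le.1 (hB y)
    have h3 := le_abs_self m
    have h4 := neg_abs_le m
    rw [abs_le]
    rcases hz with rfl | rfl <;> push_cast at h1 <;> constructor <;> linarith
  have hC : ∀ᵐ ω ∂mixtureLaw r ρ γ, ∀ n, |M (n + 1) ω - M n ω| ≤ 2 * B + 1 + |m| := by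
    filter_upwards [ae_profit_mixtureLaw r ρ γ] with ω hω n
    rw [hstep]
    exact hinc _ _ (hω n _)
  have horth : ∀ n, ∫ ω, M n ω * (M (n + 1) ω - M n ω) ∂mixtureLaw r ρ γ = 0 := by
    intro n
    simp only [hstep]
    have hint : Integrable (fun ω => M n ω * (f (capital r x ω n
        + profit r (capital r x ω n) (ω n)) - f (capital r x ω n) - m)) (mixtureLaw r ρ γ) := by
      refine Integrable.of_bound (C := n * (2 * B + 1 + |m|) * (2 * B + 1 + |m|)) ?_ ?_
      · simp only [← hstep]
        exact ((hM n).mul ((hM (n + 1)).sub (hM n))).aestronglyMeasurable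
      · filter_upwards [hC] with ω hω
        rw [← hstep, norm_mul]
        have := abs_sub_le_of_abs_increment_le (u := fun n => M n ω) hω 0 n
        simp only [h0, sub_zero, zero_add] at this
        exact mul_le_mul this (hω n) (norm_nonneg _) ((abs_nonneg _).trans this)
    -- With the capital frozen at `y`, the first factor is constant and the second has mean zero by
    -- the Poisson equation.
    refine (integral_capital_turn (F := fun y t =>
      (f y - f x - n * m) * (f (y + profit r y t) - f y - m)) hint).trans ?_
    refine integral_eq_zero_of_ae (.of_forall fun y => ?_)
    change ∫ t, _ ∂_ = (0 : ℝ)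
    rw [integral_const_mul, integral_comp_profit r ρ γ y (fun z => f (y + z) - f y - m),
      ← sub_eq_add_neg]
    linear_combination (f y - f x - n * m) * hf y
  filter_upwards [ae_tendsto_div_of_orthogonal_increments hM h0 hC horth] with ω hω
  -- Replacing `f` by the identity at both ends costs at most `2 * B`, negligible after division by
  -- `n`.
  have hbdd : Tendsto (fun n : ℕ =>
      (f x - x - (f (capital r x ω n) - capital r x ω n)) / (n : ℝ)) atTop (𝓝 0) := by
    refine squeeze_zero_norm (fun n => ?_) (tendsto_const_div_atTop_nhds_zero_nat (2 * B))
    rw [norm_div, Real.norm_natCast]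
    gcongr
    refine (norm_sub_le _ _).trans ?_
    have h1 := hB x
    have h2 := hB (capital r x ω n)
    rw [← Real.norm_eq_abs] at h1 h2
    linarith
  have hsum := (hω.add hbdd).add_const m
  rw [add_zero, zero_add] at hsum
  refine hsum.congr' ?_
  filter_upwards [eventually_ge_atTop 1] with n hn
  have : (n : ℝ) ≠ 0 := by positivity
  simp only [M]
  push_cast
  field_simp
  ring

lemma IsRateOfProfit.unique {r : ℕ} {ρ γ : I} {m m' : ℝ} (h : IsRateOfProfit r ρ γ m)
    (h' : IsRateOfProfit r ρ γ m') : m = m' := by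
  obtain ⟨ω, h1, h2⟩ := ((h 0).and (h' 0)).exists
  exact tendsto_nhds_unique h1 h2

end Capital

/-! ### The rate of the mixture and its large-period limit -/

section Rate

variable {r : ℕ} {ρ γ : I}

lemma coe_p₁ (ρ : I) : (p₁ ρ : ℝ) = 1 / (1 + ρ) := rfl

lemma half_lt_p₁ (hρ : ρ ∈ Set.Ioo 0 1) : 1 / 2 < (p₁ ρ : ℝ) := by
  have h0 : (0 : ℝ) < ρ := hρ.1
  have h1 : (ρ : ℝ) < 1 := hρ.2
  rw [coe_p₁]
  exact one_div_lt_one_div_of_lt (by linarith) (by linarith)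

lemma p₀_le_half (r : ℕ) (ρ : I) : (p₀ r ρ : ℝ) ≤ 1 / 2 := by
  have h0 : (0 : ℝ) ≤ (ρ : ℝ) ^ (r - 1) := pow_nonneg ρ.2.1 _
  have h1 : (ρ : ℝ) ^ (r - 1) ≤ 1 := pow_le_one₀ ρ.2.1 ρ.2.2
  change (ρ : ℝ) ^ (r - 1) / (1 + (ρ : ℝ) ^ (r - 1)) ≤ 1 / 2
  rw [div_le_div_iff₀ (by linarith) two_pos]
  linarith

lemma half_lt_mixedProb (hρ : ρ ∈ Set.Ioo 0 1) (hγ : γ ∈ Set.Ioo 0 1) :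
    1 / 2 < mixedProb γ (p₁ ρ) := by
  have h := half_lt_p₁ hρ
  have h1 : (γ : ℝ) < 1 := hγ.2
  unfold mixedProb
  nlinarith

lemma mixedProb_le_one (γ q : I) : mixedProb γ q ≤ 1 := by
  have h0 := γ.2.1
  have h1 := γ.2.2
  have h2 := q.2.2
  unfold mixedProb
  nlinarith

/-- Game `A` alone contributes this much. The bound does not depend on `r`, which matters at
multiples of `r`, where `p₀` tends to `0` as `r` grows. -/
lemma half_mul_le_mixedProb (γ q : I) : (γ : ℝ) / 2 ≤ mixedProb γ q := by
  have h1 := γ.2.2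
  have h2 := q.2.1
  unfold mixedProb
  nlinarith

lemma mixedProb_p₀_le (hρ : ρ ∈ Set.Ioo 0 1) (hγ : γ ∈ Set.Ioo 0 1) :
    mixedProb γ (p₀ r ρ) ≤ mixedProb γ (p₁ ρ) := by
  have h := half_lt_p₁ hρ
  have h' := p₀_le_half r ρ
  have h1 : (γ : ℝ) < 1 := hγ.2
  unfold mixedProb
  have : (1 - (γ : ℝ)) * p₀ r ρ ≤ (1 - γ) * p₁ ρ :=
    mul_le_mul_of_nonneg_left (by linarith) (by linarith)
  linarith

lemma mixedProb_pos (hγ : γ ∈ Set.Ioo 0 1) (q : I) : 0 < mixedProb γ q := by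
  have h0 : (0 : ℝ) < γ := hγ.1
  have := half_mul_le_mixedProb γ q
  linarith

theorem isRateOfProfit_speed (hr : 2 ≤ r) (hρ : ρ ∈ Set.Ioo 0 1) (hγ : γ ∈ Set.Ioo 0 1) :
    IsRateOfProfit r ρ γ (speed r (mixedProb γ (p₀ r ρ)) (mixedProb γ (p₁ ρ))) := by
  obtain ⟨f, B, hB, hf⟩ := exists_poisson_solution hr (mixedProb_pos hγ _)
    (mixedProb_p₀_le (r := r) hρ hγ) (half_lt_mixedProb hρ hγ) (mixedProb_le_one _ _)
  exact isRateOfProfit_of_poisson hB hf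

/-- For fixed `ρ` and `γ`, rates of profit of the mixture come close to the drift away from the
multiples of `r`, because the cost of passing a multiple of `r` remains bounded as `r` grows. -/
lemma drift_le_of_speed_le {b : ℝ} (hρ : ρ ∈ Set.Ioo 0 1) (hγ : γ ∈ Set.Ioo 0 1)
    (hb : ∀ r, 3 ≤ r → speed r (mixedProb γ (p₀ r ρ)) (mixedProb γ (p₁ ρ)) ≤ b) :
    2 * mixedProb γ (p₁ ρ) - 1 ≤ b := by
  have hγ0 : (0 : ℝ) < γ := hγ.1
  have hp := half_lt_mixedProb hρ hγ
  have hp1 := mixedProb_le_one γ (p₁ ρ)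
  have hlim := ((tendsto_const_div_atTop_nhds_zero_nat
    (8 / ((1 - (1 - mixedProb γ (p₁ ρ)) / mixedProb γ (p₁ ρ)) * γ))).const_sub 1).const_mul
    (2 * mixedProb γ (p₁ ρ) - 1)
  rw [sub_zero, mul_one] at hlim
  have hpow : ∀ᶠ r : ℕ in atTop,
      ((1 - mixedProb γ (p₁ ρ)) / mixedProb γ (p₁ ρ)) ^ (r - 1) ≤ (γ : ℝ) / 4 :=
    ((tendsto_pow_atTop_nhds_zero_of_lt_one (ratio_nonneg hp hp1) (ratio_lt_one hp)).comp
      (tendsto_sub_atTop_nat 1)).eventually_le_const (by positivity)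
  refine le_of_tendsto hlim ?_
  filter_upwards [hpow, eventually_ge_atTop 3] with r hT hr
  exact (le_speed (by omega) hγ0 (half_mul_le_mixedProb _ _) (mixedProb_p₀_le hρ hγ) hp hp1
    hT).trans (hb r hr)

end Rate

end Parrondo

theorem theorem2 :
    (∀ (r : ℕ) (ρ γ : unitInterval), 3 ≤ r → ρ ∈ Set.Ioo 0 1 → γ ∈ Set.Ioo 0 1 →
      ∃! m : ℝ, Parrondo.IsRateOfProfit r ρ γ m) ∧
    IsLUB {m : ℝ | ∃ (r : ℕ) (ρ γ : unitInterval), 3 ≤ r ∧ ρ ∈ Set.Ioo 0 1 ∧ γ ∈ Set.Ioo 0 1 ∧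
      Parrondo.IsRateOfProfit r ρ γ m} 1 := by
  refine ⟨fun r ρ γ hr hρ hγ => ⟨_, Parrondo.isRateOfProfit_speed (by omega) hρ hγ,
    fun m hm => hm.unique (Parrondo.isRateOfProfit_speed (by omega) hρ hγ)⟩, ?_, ?_⟩
  · rintro m ⟨r, ρ, γ, hr, hρ, hγ, hm⟩
    rw [hm.unique (Parrondo.isRateOfProfit_speed (by omega) hρ hγ)]
    exact Parrondo.speed_le_one (by omega) (Parrondo.mixedProb_pos hγ _)
      (Parrondo.mixedProb_p₀_le hρ hγ) (Parrondo.half_lt_mixedProb hρ hγ)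
      (Parrondo.mixedProb_le_one _ _)
  · intro b hb
    -- One parameter suffices: `ρ = γ = η`. The left side tends to `1` as `η` decreases to `0`.
    have hdrift : ∀ η : ℝ, 0 < η → η < 1 →
        2 * (η * (1 / 2) + (1 - η) * (1 / (1 + η))) - 1 ≤ b := by
      intro η h0 h1
      let e : unitInterval := ⟨η, h0.le, h1.le⟩
      have he : e ∈ Set.Ioo 0 1 := ⟨h0, h1⟩
      exact Parrondo.drift_le_of_speed_le he he fun r hr =>
        hb ⟨r, e, e, hr, he, he, Parrondo.isRateOfProfit_speed (by omega) he he⟩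
    have hcont : ContinuousAt
        (fun η : ℝ => 2 * (η * (1 / 2) + (1 - η) * (1 / (1 + η))) - 1) 0 := by
      fun_prop (disch := norm_num)
    have hlim := hcont.tendsto.mono_left (nhdsWithin_le_nhds (s := Set.Ioi 0))
    norm_num at hlim
    refine le_of_tendsto hlim ?_
    filter_upwards [Ioo_mem_nhdsGT (zero_lt_one' ℝ)] with η hη
    have := hdrift η hη.1 hη.2
    norm_num at this
    linarith
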